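/- Consider the multi-armed bandit problem with $K \ge 2$ arms and $T \ge K$ rounds. In each round $t$ the learner picks an arm $i_t \in \{1,\dots,K\}$ while, simultaneously, the adversary picks a loss vector $\ell_t \in [0,1]^K$; the learner then observes only $\ell_{t,i_t}$. Learner and adversary may use independent internal randomness; the learner may use its past arms and the losses observed for them, and an adaptive adversary may use the past arms $i_1,\dots,i_{t-1}$. Let $$\mathrm{Reg} = \max_{j \in \{1,\dots,K\}} \mathbb{E}\Big[\sum_{t=1}^T \ell_{t,i_t} - \sum_{t=1}^T \ell_{t,j}\Big], \qquad V_1 = \mathbb{E}\Big[\sum_{t=1}^T \|\ell_t - \ell_{t-1}\|_1\Big], \quad \ell_0 = 0 .$$ There are universal constants $C, c > 0$ such that for all $K \ge 2$, $T \ge K$, every $\gamma \in [K/T, 1]$ and every (possibly randomized) bandit algorithm there is an adaptive adversary for which $$V_1 \le C\, T\gamma, \qquad \mathrm{Reg} \ge c \sqrt{K T \gamma} \qquad\text{and}\qquad \mathrm{Reg} \ge c\sqrt{K V_1}.$$ Moreover the adversary can be chosen of the following form: there are independent random variables $X_{t,i}$, the law of $X_{t,i}$ depending only on $i$ (and not on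 $t$), such that $\ell_1 = X_1$; for $2 \le t \le T\gamma$, $\ell_{t,i} = X_{t,i}$ if $i = i_{t-1}$ and $\ell_{t,i} = \ell_{t-1,i}$ otherwise; and $\ell_t = 0$ for $t > T\gamma$. So only the loss of the last pulled arm is resampled in each round $2 \le t \le T\gamma$. -/

import Mathlib

open MeasureTheory ProbabilityTheory

namespace Bandit

/-- A (randomized) multi-armed bandit algorithm with `K` arms and internal randomness `Ω`.
Rounds are counted from `0`. In round `t` the learner chooses an arm from its random seed and from
what it has observed in the rounds `s < t`: the arm it pulled and the loss of that arm. -/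
structure Learner (K : ℕ) (Ω : Type*) [MeasurableSpace Ω] where
  act : (t : ℕ) → Ω → (Fin t → Fin K × ℝ) → Fin K
  measurable_act : ∀ t, Measurable (fun p : Ω × (Fin t → Fin K × ℝ) => act t p.1 p.2)

/-- A (randomized) adaptive adversary with internal randomness `Ω`. In round `t` it chooses a loss
vector in `[0,1]^K` from its random seed and from the arms pulled in the rounds `s < t`. -/
structure Adversary (K : ℕ) (Ω : Type*) [MeasurableSpace Ω] where
  loss : (t : ℕ) → Ω → (Fin t → Fin K) → Fin K → ℝ
  measurable_loss : ∀ t h i, Measurable (fun ω => loss t ω h i)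
  loss_mem : ∀ t ω h i, loss t ω h i ∈ Set.Icc (0 : ℝ) 1

section Play

variable {K : ℕ} {Ω₁ Ω₂ : Type*} [MeasurableSpace Ω₁] [MeasurableSpace Ω₂]

/-- The arm pulled in round `t` when the learner `L` with seed `ω.1` plays against the
adversary `A` with seed `ω.2`. -/
def arm (L : Learner K Ω₁) (A : Adversary K Ω₂) (ω : Ω₁ × Ω₂) (t : ℕ) : Fin K :=
  L.act t ω.1 (fun s : Fin t =>
    (arm L A ω s, A.loss s ω.2 (fun r : Fin s => arm L A ω r) (arm L A ω s)))
termination_by t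
decreasing_by
  all_goals first
    | exact s.isLt
    | exact lt_trans r.isLt s.isLt

/-- The loss vector of round `t`. -/
def lossVec (L : Learner K Ω₁) (A : Adversary K Ω₂) (ω : Ω₁ × Ω₂) (t : ℕ) : Fin K → ℝ :=
  A.loss t ω.2 (fun s : Fin t => arm L A ω s)

/-- The loss vector of the round before round `t`; it is the zero vector if `t` is the first
round. -/
def prevLossVec (L : Learner K Ω₁) (A : Adversary K Ω₂) (ω : Ω₁ × Ω₂) : ℕ → Fin K → ℝ
  | 0 => 0
  | t + 1 => lossVec L A ω t

/-- The (pseudo) regret after `T` rounds. The seeds of learner and adversary are independent,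
with laws `P` and `Q`. -/
noncomputable def regret (L : Learner K Ω₁) (A : Adversary K Ω₂)
    (P : Measure Ω₁) (Q : Measure Ω₂) (T : ℕ) : ℝ :=
  ⨆ j : Fin K, ∫ ω, (∑ t ∈ Finset.range T, lossVec L A ω t (arm L A ω t)
    - ∑ t ∈ Finset.range T, lossVec L A ω t j) ∂(P.prod Q)

/-- The expected 1-norm path-length `V₁` of the losses over `T` rounds. -/
noncomputable def pathLength (L : Learner K Ω₁) (A : Adversary K Ω₂)
    (P : Measure Ω₁) (Q : Measure Ω₂) (T : ℕ) : ℝ :=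
  ∫ ω, (∑ t ∈ Finset.range T, ∑ i : Fin K, |lossVec L A ω t i - prevLossVec L A ω t i|)
    ∂(P.prod Q)

end Play

/-- The adversary has independent samples `X t i`, whose law depends on the arm `i` only. In the
first round every arm gets a fresh sample; in each of the later ones among the first `τ` rounds only
the loss of the arm pulled in the previous round is replaced by a fresh sample, and all other
coordinates stay as they are. After the first `τ` rounds all losses are zero. (Round `t`, counted
from `0`, is the `(t + 1)`-st round.) -/
def ResamplesLastArm {K : ℕ} {Ω : Type*} [MeasurableSpace Ω] (A : Adversary K Ω) (Q : Measure Ω)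
    (T : ℕ) (τ : ℝ) : Prop :=
  ∃ X : Fin T → Fin K → Ω → ℝ,
    (∀ t i, Measurable (X t i)) ∧
    iIndepFun (fun p : Fin T × Fin K => X p.1 p.2) Q ∧
    (∀ s t i, IdentDistrib (X s i) (X t i) Q Q) ∧
    (∀ (hT : 0 < T), 1 ≤ τ → ∀ ω h i, A.loss 0 ω h i = X ⟨0, hT⟩ i ω) ∧
    (∀ (s : ℕ) (hs : s + 1 < T), (s : ℝ) + 2 ≤ τ → ∀ ω (h : Fin (s + 1) → Fin K) (i : Fin K),
      A.loss (s + 1) ω h i =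
        if i = h (Fin.last s) then X ⟨s + 1, hs⟩ i ω
        else A.loss s ω (fun r : Fin s => h r.castSucc) i) ∧
    (∀ t : ℕ, t < T → τ < (t : ℝ) + 1 → ∀ ω h i, A.loss t ω h i = 0)

end Bandit

/-! The adversary hides an i.i.d. stochastic bandit inside a slowly moving loss sequence. All losses
are bits of mean 1/2, except that arm `j` has mean 1/2 - ε. A bit is replaced as soon as the learner
has seen it, so given the observations so far, the current loss of every arm is still a fresh sample
(`hist_update`, `bitExp_fresh`). For the learner the first `M = ⌊Tγ⌋₊` rounds are therefore an
ordinary stochastic bandit, with lower bound of order √(KM). Yet only one coordinate moves per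
round, so the path length is at most 2K + M instead of order KM.

The lower bound is a change of measure. `bitExp_armProb_eq` compares arm `j` being better with all
arms being fair, and `bitExp_log_histRatio` gives the relative entropy as a multiple of the expected
pulls of `j` in the fair game. A linearized Pinsker inequality then bounds the pulls of `j` when it
is better (`bitExp_pulls_le`). Fair pulls sum to `M` over the arms, so with ε of order √(K/M) the
average arm is missed in a constant fraction of the rounds (`le_sum_bitExp_excess`). -/

namespace Bandit

/-! ### Observed histories and measurability of the play -/

section History

variable {K : ℕ} {Ω₁ Ω₂ : Type*} [MeasurableSpace Ω₁] [MeasurableSpace Ω₂]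

/-- What the learner has observed before round `n`: the arms it pulled and their losses. -/
def hist (L : Learner K Ω₁) (A : Adversary K Ω₂) (ω : Ω₁ × Ω₂) (n : ℕ) : Fin n → Fin K × ℝ :=
  fun s => (arm L A ω s, lossVec L A ω s (arm L A ω s))

theorem arm_eq_act_hist (L : Learner K Ω₁) (A : Adversary K Ω₂) (ω : Ω₁ × Ω₂) (n : ℕ) :
    arm L A ω n = L.act n ω.1 (hist L A ω n) := by
  rw [arm]; rfl

/-- A history extended by one observation. -/
def extend {n : ℕ} (h : Fin n → Fin K × ℝ) (q : Fin K × ℝ) : Fin (n + 1) → Fin K × ℝ :=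
  Fin.snoc (α := fun _ => Fin K × ℝ) h q

@[simp] theorem extend_castSucc {n : ℕ} (h : Fin n → Fin K × ℝ) (q : Fin K × ℝ) (s : Fin n) :
    extend h q s.castSucc = h s := by
  simp [extend]

@[simp] theorem extend_last {n : ℕ} (h : Fin n → Fin K × ℝ) (q : Fin K × ℝ) :
    extend h q (Fin.last n) = q := by
  simp [extend]

theorem hist_succ (L : Learner K Ω₁) (A : Adversary K Ω₂) (ω : Ω₁ × Ω₂) (n : ℕ) :
    hist L A ω (n + 1) =
      extend (hist L A ω n) (arm L A ω n, lossVec L A ω n (arm L A ω n)) := by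
  funext s
  refine Fin.lastCases ?_ (fun s => ?_) s
  · rw [extend_last]; rfl
  · rw [extend_castSucc]; rfl

theorem measurable_arm_left [MeasurableSingletonClass Ω₂] (L : Learner K Ω₁) (A : Adversary K Ω₂)
    (ω₂ : Ω₂) (t : ℕ) : Measurable fun ω₁ => arm L A (ω₁, ω₂) t := by
  induction t using Nat.strong_induction_on with
  | _ t ih =>
    have h1 : Measurable fun ω₁ => hist L A (ω₁, ω₂) t := by
      refine measurable_pi_lambda _ fun s => (ih s s.isLt).prodMk ?_
      have h2 : Measurable fun ω₁ =>
          ((fun r : Fin s => arm L A (ω₁, ω₂) r), arm L A (ω₁, ω₂) s) :=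
        (measurable_pi_lambda _ fun r : Fin s => ih r (r.isLt.trans s.isLt)).prodMk (ih s s.isLt)
      have h3 : Measurable fun q : (Fin s → Fin K) × Fin K => A.loss s ω₂ q.1 q.2 :=
        measurable_of_finite _
      exact h3.comp h2
    simp_rw [arm_eq_act_hist]
    exact (L.measurable_act t).comp (measurable_id.prodMk h1)

theorem measurable_lossVec_left [MeasurableSingletonClass Ω₂] (L : Learner K Ω₁)
    (A : Adversary K Ω₂) (ω₂ : Ω₂) (t : ℕ) {c : Ω₁ → Fin K} (hc : Measurable c) :
    Measurable fun ω₁ => lossVec L A (ω₁, ω₂) t (c ω₁) := by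
  have h2 : Measurable fun ω₁ => ((fun r : Fin t => arm L A (ω₁, ω₂) r), c ω₁) :=
    (measurable_pi_lambda _ fun r : Fin t => measurable_arm_left L A ω₂ r).prodMk hc
  have h3 : Measurable fun q : (Fin t → Fin K) × Fin K => A.loss t ω₂ q.1 q.2 :=
    measurable_of_finite _
  exact h3.comp h2

/-- The excess loss of the learner over arm `j`. -/
def excess (L : Learner K Ω₁) (A : Adversary K Ω₂) (T : ℕ) (j : Fin K) (ω : Ω₁ × Ω₂) : ℝ :=
  ∑ t ∈ Finset.range T, lossVec L A ω t (arm L A ω t) - ∑ t ∈ Finset.range T, lossVec L A ω t j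

theorem lossVec_mem (L : Learner K Ω₁) (A : Adversary K Ω₂) (ω : Ω₁ × Ω₂) (t : ℕ) (i : Fin K) :
    lossVec L A ω t i ∈ Set.Icc (0 : ℝ) 1 := A.loss_mem _ _ _ _

theorem abs_excess_le (L : Learner K Ω₁) (A : Adversary K Ω₂) (T : ℕ) (j : Fin K)
    (ω : Ω₁ × Ω₂) : |excess L A T j ω| ≤ T := by
  rw [excess, ← Finset.sum_sub_distrib]
  refine (Finset.abs_sum_le_sum_abs _ _).trans ?_
  refine (Finset.sum_le_card_nsmul _ _ 1 fun t _ => ?_).trans (by simp)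
  have h1 := lossVec_mem L A ω t (arm L A ω t)
  have h2 := lossVec_mem L A ω t j
  rw [abs_le]
  exact ⟨by linarith [h1.1, h2.2], by linarith [h1.2, h2.1]⟩

theorem integrable_excess [Countable Ω₂] [MeasurableSingletonClass Ω₂] (L : Learner K Ω₁)
    (A : Adversary K Ω₂) (T : ℕ) (j : Fin K) (P : Measure Ω₁) (Q : Measure Ω₂)
    [IsFiniteMeasure P] [IsFiniteMeasure Q] : Integrable (excess L A T j) (P.prod Q) := by
  refine Integrable.of_bound (C := T) ?_ (ae_of_all _ fun ω => abs_excess_le L A T j ω)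
  -- As `Ω₂` is countable, measurability in the learner's seed for each fixed `ω₂` suffices.
  refine (measurable_from_prod_countable_left fun ω₂ => ?_).aestronglyMeasurable
  refine Measurable.sub ?_ ?_
  · exact Finset.measurable_fun_sum _ fun t _ =>
      measurable_lossVec_left L A ω₂ t (measurable_arm_left L A ω₂ t)
  · exact Finset.measurable_fun_sum _ fun t _ => measurable_lossVec_left L A ω₂ t measurable_const

end History

/-! ### The resampling adversary -/

section Resampler

/-- A bit as a real number. -/
def bitVal (b : Bool) : ℝ := if b then 1 else 0

theorem bitVal_mem (b : Bool) : bitVal b ∈ Set.Icc (0 : ℝ) 1 := by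
  cases b <;> simp [bitVal]

/-- The round in which the loss of arm `i` that is present in round `t` was sampled. -/
def src {K : ℕ} : (t : ℕ) → (Fin t → Fin K) → Fin K → ℕ
  | 0, _, _ => 0
  | t + 1, h, i => if i = h (Fin.last t) then t + 1 else src t (fun r => h r.castSucc) i

theorem src_le {K : ℕ} (t : ℕ) (h : Fin t → Fin K) (i : Fin K) : src t h i ≤ t := by
  induction t with
  | zero => simp [src]
  | succ t ih =>
    rw [src]; split_ifs
    · exact le_rfl
    · exact (ih _).trans t.le_succ

/-- A bit that has been seen never returns: the pull in round `n` triggers a resample in round `n +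
1`, and later resamples are later still. -/
theorem lt_src_of_pulled {K : ℕ} (x : ℕ → Fin K) {n t : ℕ} (hn : n < t) :
    n < src t (fun s : Fin t => x s) (x n) := by
  induction t with
  | zero => omega
  | succ t ih =>
    rw [src]; split_ifs with h
    · exact hn
    · refine ih (lt_of_le_of_ne (by omega) ?_)
      rintro rfl
      exact h rfl

/-- The bit sampled for arm `i` in round `s`. -/
def bit {K T : ℕ} (ω : Fin T × Fin K → Bool) (s : ℕ) (i : Fin K) : Bool :=
  -- The default is not read in rounds `t < T`, because `src_le` keeps the source at most `t`.
  if h : s < T then ω (⟨s, h⟩, i) else false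

/-- The adversary that resamples the arm pulled last during the first `M` rounds. -/
def resampler (K T M : ℕ) : Adversary K (Fin T × Fin K → Bool) where
  loss t ω h i := if t < M then bitVal (bit ω (src t h i) i) else 0
  measurable_loss _ _ _ := measurable_of_finite _
  loss_mem t ω h i := by
    split_ifs
    · exact bitVal_mem _
    · simp

variable {K T M : ℕ} {Ω₁ : Type*} [MeasurableSpace Ω₁]

theorem lossVec_resampler (L : Learner K Ω₁) (ω : Ω₁ × (Fin T × Fin K → Bool)) {t : ℕ}
    (ht : t < M) (i : Fin K) :
    lossVec L (resampler K T M) ω t i =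
      bitVal (bit ω.2 (src t (fun s : Fin t => arm L (resampler K T M) ω s) i) i) := by
  simp [lossVec, resampler, ht]

theorem lossVec_resampler_of_le (L : Learner K Ω₁) (ω : Ω₁ × (Fin T × Fin K → Bool)) {t : ℕ}
    (ht : M ≤ t) (i : Fin K) : lossVec L (resampler K T M) ω t i = 0 := by
  simp [lossVec, resampler, ht.not_gt]

theorem bit_update_of_ne (ω : Fin T × Fin K → Bool) (b : Bool) {d : Fin T × Fin K} {s : ℕ}
    {i : Fin K} (h : ¬ (s = d.1 ∧ i = d.2)) : bit (Function.update ω d b) s i = bit ω s i := by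
  unfold bit
  split_ifs with hs
  · rw [Function.update_of_ne]
    rintro rfl
    exact h ⟨rfl, rfl⟩
  · rfl

/-- The observations before round `t` do not depend on the unobserved loss present in round `t`. -/
theorem hist_update (L : Learner K Ω₁) (ω₁ : Ω₁) (ω : Fin T × Fin K → Bool) (b : Bool)
    {t : ℕ} {d : Fin T × Fin K}
    (hd : (d.1 : ℕ) = src t (fun s : Fin t => arm L (resampler K T M) (ω₁, ω) s) d.2) :
    hist L (resampler K T M) (ω₁, Function.update ω d b) t =
      hist L (resampler K T M) (ω₁, ω) t := by
  have key : ∀ n ≤ t, hist L (resampler K T M) (ω₁, Function.update ω d b) n =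
      hist L (resampler K T M) (ω₁, ω) n := by
    intro n
    induction n with
    | zero => intro _; funext s; exact s.elim0
    | succ n ih =>
      intro hn
      have h1 := ih (by omega)
      have h2 : arm L (resampler K T M) (ω₁, Function.update ω d b) n =
          arm L (resampler K T M) (ω₁, ω) n := by
        rw [arm_eq_act_hist, arm_eq_act_hist, h1]
      have h3 : (fun s : Fin n => arm L (resampler K T M) (ω₁, Function.update ω d b) s) =
          fun s : Fin n => arm L (resampler K T M) (ω₁, ω) s :=
        funext fun s => congrArg Prod.fst (congrFun h1 s)
      rw [hist_succ, hist_succ, h1, h2]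
      congr 2
      by_cases hM : n < M
      · rw [lossVec_resampler _ _ hM, lossVec_resampler _ _ hM, h3]
        congr 1
        refine bit_update_of_ne ω b ?_
        -- If round `n` showed bit `d`, its source in round `t` would exceed `n`, whereas a bit
        -- shown in round `n` has source at most `n`.
        rintro ⟨h4, h5⟩
        have h6 := lt_src_of_pulled (fun s => arm L (resampler K T M) (ω₁, ω) s)
          (show n < t by omega)
        rw [h5, ← hd, ← h4] at h6
        exact absurd h6 (not_lt.2 (by rw [h5]; exact src_le _ _ _))
      · rw [lossVec_resampler_of_le _ _ (not_lt.1 hM), lossVec_resampler_of_le _ _ (not_lt.1 hM)]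
  exact key t le_rfl

end Resampler

/-! ### Finite expectations over independent bits -/

section BitExpectation

/-- The expectation of `F` when the bits of arm `i` are independent with weights `p i`. -/
def bitExp {K T : ℕ} (p : Fin K → Bool → ℝ) (F : (Fin T × Fin K → Bool) → ℝ) : ℝ :=
  ∑ ω, (∏ c : Fin T × Fin K, p c.2 (ω c)) * F ω

variable {K T M : ℕ} {p : Fin K → Bool → ℝ}

theorem bitExp_add (F G : (Fin T × Fin K → Bool) → ℝ) :
    bitExp p (fun ω => F ω + G ω) = bitExp p F + bitExp p G := by
  simp [bitExp, mul_add, Finset.sum_add_distrib]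

theorem bitExp_sub (F G : (Fin T × Fin K → Bool) → ℝ) :
    bitExp p (fun ω => F ω - G ω) = bitExp p F - bitExp p G := by
  simp [bitExp, mul_sub, Finset.sum_sub_distrib]

theorem bitExp_const_mul (a : ℝ) (F : (Fin T × Fin K → Bool) → ℝ) :
    bitExp p (fun ω => a * F ω) = a * bitExp p F := by
  simp only [bitExp, Finset.mul_sum]
  exact Finset.sum_congr rfl fun ω _ => by ring

theorem bitExp_sum {ι : Type*} (s : Finset ι) (F : ι → (Fin T × Fin K → Bool) → ℝ) :
    bitExp p (fun ω => ∑ i ∈ s, F i ω) = ∑ i ∈ s, bitExp p (F i) := by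
  simp only [bitExp, Finset.mul_sum]
  exact Finset.sum_comm

theorem bitExp_const (hp : ∀ i, ∑ b, p i b = 1) (a : ℝ) :
    bitExp p (fun _ : Fin T × Fin K → Bool => a) = a := by
  rw [bitExp, ← Finset.sum_mul]
  have := (Finset.prod_univ_sum (fun _ : Fin T × Fin K => (Finset.univ : Finset Bool))
    (fun c b => p c.2 b)).symm
  rw [Fintype.piFinset_univ] at this
  rw [this]
  simp only [hp, Finset.prod_const_one, one_mul]

theorem bitExp_mono (hp : ∀ i b, 0 ≤ p i b) {F G : (Fin T × Fin K → Bool) → ℝ}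
    (h : ∀ ω, F ω ≤ G ω) : bitExp p F ≤ bitExp p G :=
  Finset.sum_le_sum fun ω _ =>
    mul_le_mul_of_nonneg_left (h ω) (Finset.prod_nonneg fun _ _ => hp _ _)

/-- Detailed balance: both sides carry the weights of the old and the new bit at `d`. Hence swapping
the two preserves weight in `bitExp_resample`. -/
theorem prod_update_mul (d : Fin T × Fin K) (ω : Fin T × Fin K → Bool) (b : Bool) :
    (∏ c, p c.2 (Function.update ω d b c)) * p d.2 (ω d) = (∏ c, p c.2 (ω c)) * p d.2 b := by
  rw [Fintype.prod_eq_mul_prod_compl d, Fintype.prod_eq_mul_prod_compl d (fun c => p c.2 (ω c)),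
    Function.update_self]
  have : ∏ c ∈ {d}ᶜ, p c.2 (Function.update ω d b c) = ∏ c ∈ {d}ᶜ, p c.2 (ω c) := by
    refine Finset.prod_congr rfl fun c hc => ?_
    rw [Function.update_of_ne (by simpa using hc)]
  rw [this]; ring

/-- Resampling one bit does not change expectations. -/
theorem bitExp_resample (hp : ∀ i, ∑ b, p i b = 1) (d : Fin T × Fin K)
    (F : (Fin T × Fin K → Bool) → ℝ) :
    bitExp p (fun ω => ∑ b, p d.2 b * F (Function.update ω d b)) = bitExp p F := by
  let e : (Fin T × Fin K → Bool) × Bool → (Fin T × Fin K → Bool) × Bool :=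
    fun q => (Function.update q.1 d q.2, q.1 d)
  have he : Function.Involutive e := by
    rintro ⟨ω, b⟩
    simp [e]
  have h1 : bitExp p (fun ω => ∑ b, p d.2 b * F (Function.update ω d b)) =
      ∑ q : (Fin T × Fin K → Bool) × Bool,
        (∏ c, p c.2 ((e q).1 c)) * p d.2 (e q).2 * F (e q).1 := by
    rw [Fintype.sum_prod_type]
    simp only [bitExp, Finset.mul_sum]
    refine Finset.sum_congr rfl fun ω _ => Finset.sum_congr rfl fun b _ => ?_
    rw [prod_update_mul]; ring
  refine h1.trans ((Equiv.sum_comp he.toPerm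
    (fun q => (∏ c, p c.2 (q.1 c)) * p d.2 q.2 * F q.1)).trans ?_)
  rw [Fintype.sum_prod_type, bitExp]
  refine Finset.sum_congr rfl fun ω _ => ?_
  dsimp only
  rw [← Finset.sum_mul, ← Finset.mul_sum, hp, mul_one]

variable {Ω₁ : Type*} [MeasurableSpace Ω₁]

/-- Given the observations before round `n`, the loss that an arm has in round `n` is distributed
like a fresh sample. -/
theorem bitExp_fresh (hp : ∀ i, ∑ b, p i b = 1) (L : Learner K Ω₁) (ω₁ : Ω₁) {n : ℕ}
    (hn : n < T) (c : (Fin n → Fin K × ℝ) → Fin K) (G : (Fin n → Fin K × ℝ) → Bool → ℝ) :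
    bitExp p (fun ω : Fin T × Fin K → Bool =>
      G (hist L (resampler K T M) (ω₁, ω) n)
        (bit ω (src n (fun s : Fin n => arm L (resampler K T M) (ω₁, ω) s)
          (c (hist L (resampler K T M) (ω₁, ω) n))) (c (hist L (resampler K T M) (ω₁, ω) n)))) =
    bitExp p (fun ω : Fin T × Fin K → Bool =>
      ∑ b, p (c (hist L (resampler K T M) (ω₁, ω) n)) b *
        G (hist L (resampler K T M) (ω₁, ω) n) b) := by
  set H : (Fin T × Fin K → Bool) → Fin n → Fin K × ℝ :=
    fun ω => hist L (resampler K T M) (ω₁, ω) n with hH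
  let D : (Fin n → Fin K × ℝ) → Fin T × Fin K := fun h =>
    (⟨src n (fun s => (h s).1) (c h), (src_le _ _ _).trans_lt hn⟩, c h)
  have hbit : ∀ ω, bit ω (src n (fun s : Fin n => arm L (resampler K T M) (ω₁, ω) s) (c (H ω)))
      (c (H ω)) = ω (D (H ω)) := fun ω => dif_pos ((src_le _ _ _).trans_lt hn)
  have hinv : ∀ ω d b, D (H ω) = d → H (Function.update ω d b) = H ω := by
    rintro ω d b rfl
    exact hist_update L ω₁ ω b rfl
  -- The location of the current bit is random, so the expectation is split by its value `d`. The
  -- event that it equals `d` does not depend on bit `d`; the forward direction restores the old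
  -- value.
  have hiff : ∀ ω d b, D (H (Function.update ω d b)) = d ↔ D (H ω) = d := by
    intro ω d b
    constructor
    · intro h
      have := hinv _ d (ω d) h
      rw [Function.update_idem, Function.update_eq_self] at this
      rw [this, h]
    · intro h
      rw [hinv ω d b h, h]
  have hsplit : ∀ F : (Fin T × Fin K → Bool) → ℝ,
      bitExp p F = ∑ d, bitExp p (fun ω => if D (H ω) = d then F ω else 0) := by
    intro F
    rw [← bitExp_sum]
    simp
  refine (congrArg (bitExp p) (funext fun ω => congrArg (G (H ω)) (hbit ω))).trans ?_
  rw [hsplit, hsplit (fun ω => ∑ b, p (c (H ω)) b * G (H ω) b)]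
  refine Finset.sum_congr rfl fun d _ => ?_
  rw [← bitExp_resample hp d]
  congr 1
  funext ω
  by_cases h : D (H ω) = d
  · have hc : d.2 = c (H ω) := by rw [← h]
    simp only [if_true, h, hinv ω d _ h, Function.update_self, hc]
  · simp only [(hiff ω d _).not.2 h, if_false, h, mul_zero, Finset.sum_const_zero]

/-- The expectation after one more round, in terms of the observations before that round. -/
theorem bitExp_hist_succ (hp : ∀ i, ∑ b, p i b = 1) (L : Learner K Ω₁) (ω₁ : Ω₁) {n : ℕ}
    (hn : n < M) (hM : M ≤ T) (F : (Fin (n + 1) → Fin K × ℝ) → ℝ) :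
    bitExp p (fun ω : Fin T × Fin K → Bool => F (hist L (resampler K T M) (ω₁, ω) (n + 1))) =
    bitExp p (fun ω : Fin T × Fin K → Bool =>
      ∑ b, p (arm L (resampler K T M) (ω₁, ω) n) b *
        F (extend (hist L (resampler K T M) (ω₁, ω) n)
          (arm L (resampler K T M) (ω₁, ω) n, bitVal b))) := by
  have := bitExp_fresh (M := M) hp L ω₁ (hn.trans_le hM) (fun h => L.act n ω₁ h)
    (fun h b => F (extend h (L.act n ω₁ h, bitVal b)))
  simp_rw [hist_succ, lossVec_resampler L _ hn, arm_eq_act_hist L _ _ n]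
  exact this

/-- Serves both sides of the regret: `c` is either the learner's rule or a constant comparator. -/
theorem bitExp_lossVec (hp : ∀ i, ∑ b, p i b = 1) (L : Learner K Ω₁) (ω₁ : Ω₁) {n : ℕ}
    (hn : n < M) (hM : M ≤ T) (c : (Fin n → Fin K × ℝ) → Fin K) :
    bitExp p (fun ω : Fin T × Fin K → Bool => lossVec L (resampler K T M) (ω₁, ω) n
      (c (hist L (resampler K T M) (ω₁, ω) n))) =
    bitExp p (fun ω : Fin T × Fin K → Bool =>
      p (c (hist L (resampler K T M) (ω₁, ω) n)) true) := by
  have := bitExp_fresh (M := M) hp L ω₁ (hn.trans_le hM) c (fun _ b => bitVal b)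
  simp_rw [lossVec_resampler L _ hn]
  rw [this]
  simp [bitVal]

end BitExpectation

/-! ### Change of measure and the stochastic lower bound -/

section ChangeOfMeasure

variable {K T M : ℕ} {Ω₁ : Type*} [MeasurableSpace Ω₁]

/-- Bit probabilities when arm `j` has mean `1/2 - ε` and all other arms have mean `1/2`. -/
noncomputable def armProb (ε : ℝ) (j i : Fin K) (b : Bool) : ℝ :=
  if i = j then (if b then 1 / 2 - ε else 1 / 2 + ε) else 1 / 2

/-- Bit probabilities when all arms have mean `1/2`. -/
noncomputable def fairProb (_ : Fin K) (_ : Bool) : ℝ := 1 / 2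

theorem sum_armProb (ε : ℝ) (j i : Fin K) : ∑ b, armProb ε j i b = 1 := by
  by_cases h : i = j <;> simp [armProb, h] <;> norm_num

theorem sum_fairProb (i : Fin K) : ∑ b, fairProb i b = 1 := by
  simp [fairProb]

theorem fairProb_nonneg (i : Fin K) (b : Bool) : 0 ≤ fairProb i b := by
  simp [fairProb]

theorem armProb_nonneg {ε : ℝ} (h0 : 0 ≤ ε) (h1 : ε ≤ 1 / 2) (j i : Fin K) (b : Bool) :
    0 ≤ armProb ε j i b := by
  unfold armProb
  split_ifs <;> linarith

/-- The likelihood ratio of one observation. -/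
noncomputable def obsRatio (ε : ℝ) (j : Fin K) (q : Fin K × ℝ) : ℝ :=
  if q.1 = j then (if q.2 = 1 then 1 - 2 * ε else 1 + 2 * ε) else 1

theorem fairProb_mul_obsRatio (ε : ℝ) (j i : Fin K) (b : Bool) :
    fairProb i b * obsRatio ε j (i, bitVal b) = armProb ε j i b := by
  by_cases h : i = j <;> cases b <;> simp [fairProb, obsRatio, armProb, bitVal, h] <;> ring

theorem obsRatio_pos {ε : ℝ} (h0 : 0 ≤ ε) (h1 : ε < 1 / 2) (j : Fin K) (q : Fin K × ℝ) :
    0 < obsRatio ε j q := by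
  unfold obsRatio
  split_ifs <;> linarith

/-- The likelihood ratio of a history. -/
noncomputable def histRatio (ε : ℝ) (j : Fin K) {n : ℕ} (h : Fin n → Fin K × ℝ) : ℝ :=
  ∏ s, obsRatio ε j (h s)

theorem histRatio_pos {ε : ℝ} (h0 : 0 ≤ ε) (h1 : ε < 1 / 2) (j : Fin K) {n : ℕ}
    (h : Fin n → Fin K × ℝ) : 0 < histRatio ε j h :=
  Finset.prod_pos fun _ _ => obsRatio_pos h0 h1 _ _

theorem histRatio_extend (ε : ℝ) (j : Fin K) {n : ℕ} (h : Fin n → Fin K × ℝ) (q : Fin K × ℝ) :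
    histRatio ε j (extend h q) = histRatio ε j h * obsRatio ε j q := by
  simp [histRatio, Fin.prod_univ_castSucc]

/-- The number of pulls of arm `j` in a history. -/
noncomputable def pulls (j : Fin K) {n : ℕ} (h : Fin n → Fin K × ℝ) : ℝ :=
  ∑ s, if (h s).1 = j then 1 else 0

theorem pulls_extend (j : Fin K) {n : ℕ} (h : Fin n → Fin K × ℝ) (q : Fin K × ℝ) :
    pulls j (extend h q) = pulls j h + if q.1 = j then 1 else 0 := by
  rw [pulls, Fin.sum_univ_castSucc]
  simp only [extend_castSucc, extend_last]
  rfl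

theorem pulls_nonneg (j : Fin K) {n : ℕ} (h : Fin n → Fin K × ℝ) : 0 ≤ pulls j h :=
  Finset.sum_nonneg fun _ _ => by split_ifs <;> norm_num

theorem sum_pulls {n : ℕ} (h : Fin n → Fin K × ℝ) : ∑ j, pulls j h = n := by
  simp only [pulls]
  rw [Finset.sum_comm]
  simp

theorem pulls_le (j : Fin K) {n : ℕ} (h : Fin n → Fin K × ℝ) : pulls j h ≤ n := by
  rw [← sum_pulls h]
  exact Finset.single_le_sum (f := fun j => pulls j h) (fun _ _ => pulls_nonneg _ _)
    (Finset.mem_univ j)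

/-- The learner's rule is the same under both laws, so each round contributes only the ratio of the
laws of one fresh bit. -/
theorem bitExp_armProb_eq (ε : ℝ) (j : Fin K) (L : Learner K Ω₁) (ω₁ : Ω₁) (hM : M ≤ T) {n : ℕ}
    (hn : n ≤ M) (F : (Fin n → Fin K × ℝ) → ℝ) :
    bitExp (armProb ε j) (fun ω : Fin T × Fin K → Bool =>
      F (hist L (resampler K T M) (ω₁, ω) n)) =
    bitExp fairProb (fun ω : Fin T × Fin K → Bool =>
      histRatio ε j (hist L (resampler K T M) (ω₁, ω) n) *
        F (hist L (resampler K T M) (ω₁, ω) n)) := by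
  induction n with
  | zero =>
    have h1 : ∀ ω : Fin T × Fin K → Bool, hist L (resampler K T M) (ω₁, ω) 0 = Fin.elim0 :=
      fun ω => funext fun s => s.elim0
    simp_rw [h1]
    rw [bitExp_const (sum_armProb ε j), bitExp_const sum_fairProb]
    simp [histRatio]
  | succ n ih =>
    rw [bitExp_hist_succ (sum_armProb ε j) L ω₁ hn hM F,
      bitExp_hist_succ sum_fairProb L ω₁ hn hM (fun h => histRatio ε j h * F h)]
    simp_rw [arm_eq_act_hist L _ _ n]
    refine (ih (by omega) (fun h => ∑ b, armProb ε j (L.act n ω₁ h) b *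
      F (extend h (L.act n ω₁ h, bitVal b)))).trans ?_
    congr 1
    funext ω
    rw [Finset.mul_sum]
    refine Finset.sum_congr rfl fun b _ => ?_
    rw [histRatio_extend, ← fairProb_mul_obsRatio]
    ring

/-- Chain rule for relative entropy: a pull of `j` adds the fair average of log(1 ± 2ε), and any
other pull adds nothing. -/
theorem bitExp_log_histRatio {ε : ℝ} (h0 : 0 ≤ ε) (h1 : ε < 1 / 2) (j : Fin K)
    (L : Learner K Ω₁) (ω₁ : Ω₁) (hM : M ≤ T) {n : ℕ} (hn : n ≤ M) :
    bitExp fairProb (fun ω : Fin T × Fin K → Bool =>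
      Real.log (histRatio ε j (hist L (resampler K T M) (ω₁, ω) n))) =
    Real.log (1 - 4 * ε ^ 2) / 2 * bitExp fairProb (fun ω : Fin T × Fin K → Bool =>
      pulls j (hist L (resampler K T M) (ω₁, ω) n)) := by
  induction n with
  | zero => simp [histRatio, pulls, bitExp]
  | succ n ih =>
    rw [bitExp_hist_succ sum_fairProb L ω₁ hn hM (fun h => Real.log (histRatio ε j h)),
      bitExp_hist_succ sum_fairProb L ω₁ hn hM (fun h => pulls j h)]
    have hlog : Real.log (1 - 4 * ε ^ 2) = Real.log (1 - 2 * ε) + Real.log (1 + 2 * ε) := by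
      rw [← Real.log_mul (by linarith) (by linarith)]
      congr 1; ring
    have h2 : ∀ ω : Fin T × Fin K → Bool,
        ∑ b, fairProb (arm L (resampler K T M) (ω₁, ω) n) b *
          Real.log (histRatio ε j (extend (hist L (resampler K T M) (ω₁, ω) n)
            (arm L (resampler K T M) (ω₁, ω) n, bitVal b))) =
        Real.log (histRatio ε j (hist L (resampler K T M) (ω₁, ω) n)) +
          Real.log (1 - 4 * ε ^ 2) / 2 *
            if arm L (resampler K T M) (ω₁, ω) n = j then 1 else 0 := by
      intro ω
      simp_rw [histRatio_extend,
        Real.log_mul (histRatio_pos h0 h1 _ _).ne' (obsRatio_pos h0 h1 _ _).ne']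
      rw [hlog]
      by_cases h : arm L (resampler K T M) (ω₁, ω) n = j <;>
        simp [fairProb, obsRatio, bitVal, h] <;> ring
    have h3 : ∀ ω : Fin T × Fin K → Bool,
        ∑ b, fairProb (arm L (resampler K T M) (ω₁, ω) n) b *
          pulls j (extend (hist L (resampler K T M) (ω₁, ω) n)
            (arm L (resampler K T M) (ω₁, ω) n, bitVal b)) =
        pulls j (hist L (resampler K T M) (ω₁, ω) n) +
            if arm L (resampler K T M) (ω₁, ω) n = j then 1 else 0 := by
      intro ω
      simp only [pulls_extend, Fintype.sum_bool, fairProb]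
      ring
    simp_rw [h2, h3, bitExp_add, bitExp_const_mul, ih (by omega)]
    ring

/-- A linearized form of Pinsker's inequality. -/
theorem sub_one_mul_le {x g : ℝ} (hx : 0 < x) (hg0 : 0 ≤ g) (hg1 : g ≤ 1) :
    (x - 1) * g ≤ 16 * (x - 1 - Real.log x) + 1 / 16 := by
  have h1 := Real.log_le_sub_one_of_pos hx
  -- The tangent at 16/15, where 16(x - 1 - log x) - (x - 1) is smallest.
  have h2 : Real.log x ≤ Real.log (16 / 15) + (x * (15 / 16) - 1) := by
    have h := Real.log_le_sub_one_of_pos (show 0 < x * (15 / 16) by positivity)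
    have h3 : Real.log x = Real.log (16 / 15) + Real.log (x * (15 / 16)) := by
      rw [← Real.log_mul (by norm_num) (by positivity)]
      congr 1; ring
    linarith
  -- The bound log y ≤ y - 1 at 16/15 gives only 1/15, which is too large; applying it to the square
  -- root is sharp enough.
  have h3 : Real.log (16 / 15) ≤ 1 / 16 + 1 / 256 := by
    have h := Real.log_le_sub_one_of_pos (show (0 : ℝ) < 16 / 15 by norm_num)
    have h4 : Real.log (16 / 15) = 2 * Real.log (Real.sqrt (16 / 15)) := by
      rw [Real.log_sqrt (by norm_num)]; ring
    have h5 : Real.sqrt (16 / 15) ≤ 1 + 17 / 512 := by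
      rw [Real.sqrt_le_left (by norm_num)]; norm_num
    have h6 := Real.log_le_sub_one_of_pos (show (0 : ℝ) < Real.sqrt (16 / 15) by positivity)
    linarith
  rcases le_total x 1 with h | h
  · nlinarith
  · nlinarith

theorem neg_log_le {ε : ℝ} (h1 : ε ^ 2 ≤ 1 / 8) : -(Real.log (1 - 4 * ε ^ 2) / 2) ≤ 4 * ε ^ 2 := by
  have hpos : 0 < 1 - 4 * ε ^ 2 := by linarith
  have h := Real.one_sub_inv_le_log_of_pos hpos
  have h2 : (1 - 4 * ε ^ 2)⁻¹ ≤ 1 + 8 * ε ^ 2 := by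
    rw [inv_le_iff_one_le_mul₀ hpos]
    nlinarith [sq_nonneg ε]
  linarith

/-- Apply `sub_one_mul_le` to the likelihood ratio and the pulled fraction. The ratio has fair mean
1, so only the entropy survives, at most 4ε² per expected pull; 64 = 16 · 4. -/
theorem bitExp_pulls_le {ε : ℝ} (h0 : 0 ≤ ε) (h1 : ε ≤ 1 / 4) (j : Fin K)
    (L : Learner K Ω₁) (ω₁ : Ω₁) (hM : M ≤ T) :
    bitExp (armProb ε j) (fun ω : Fin T × Fin K → Bool =>
      pulls j (hist L (resampler K T M) (ω₁, ω) M)) ≤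
    (1 + 64 * ε ^ 2 * M) * bitExp fairProb (fun ω : Fin T × Fin K → Bool =>
      pulls j (hist L (resampler K T M) (ω₁, ω) M)) + M / 16 := by
  rcases Nat.eq_zero_or_pos M with rfl | hM0
  · simp [pulls, bitExp]
  have hM' : (0 : ℝ) < M := by exact_mod_cast hM0
  set H : (Fin T × Fin K → Bool) → Fin M → Fin K × ℝ :=
    fun ω => hist L (resampler K T M) (ω₁, ω) M with hH
  have hone : bitExp fairProb (fun ω => histRatio ε j (H ω)) = 1 := by
    have := bitExp_armProb_eq ε j L ω₁ hM le_rfl (fun _ => 1)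
    rw [bitExp_const (sum_armProb ε j)] at this
    simpa using this.symm
  have hlog := bitExp_log_histRatio h0 (by linarith : ε < 1 / 2) j L ω₁ hM le_rfl
  rw [bitExp_armProb_eq ε j L ω₁ hM le_rfl (fun h => pulls j h)]
  have hpt : ∀ ω, histRatio ε j (H ω) * pulls j (H ω) ≤ pulls j (H ω) +
      (M * 16) * (histRatio ε j (H ω) - 1 - Real.log (histRatio ε j (H ω))) + M / 16 := by
    intro ω
    have h2 := sub_one_mul_le (histRatio_pos h0 (by linarith : ε < 1 / 2) j (H ω))
      (div_nonneg (pulls_nonneg j (H ω)) hM'.le) ((div_le_one hM').2 (pulls_le j (H ω)))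
    have h3 := mul_le_mul_of_nonneg_left h2 hM'.le
    have h4 : M * ((histRatio ε j (H ω) - 1) * (pulls j (H ω) / M)) =
        (histRatio ε j (H ω) - 1) * pulls j (H ω) := by
      field_simp
    rw [h4] at h3
    linarith
  refine (bitExp_mono fairProb_nonneg hpt).trans ?_
  rw [bitExp_add, bitExp_add, bitExp_const_mul, bitExp_sub, bitExp_sub, hone,
    bitExp_const sum_fairProb, bitExp_const sum_fairProb, hlog]
  have hN : 0 ≤ bitExp fairProb (fun ω => pulls j (H ω)) := by
    have := bitExp_mono fairProb_nonneg (fun ω => pulls_nonneg j (H ω))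
    rwa [bitExp_const sum_fairProb] at this
  have h5 := mul_le_mul_of_nonneg_right (neg_log_le (ε := ε) (by nlinarith)) hN
  have h6 := mul_le_mul_of_nonneg_left h5 (show 0 ≤ (M : ℝ) * 16 by positivity)
  linarith

/-- Each of the first `M` rounds costs ε unless `j` is pulled; later rounds have zero loss. -/
theorem bitExp_excess (ε : ℝ) (j : Fin K) (L : Learner K Ω₁) (ω₁ : Ω₁) (hM : M ≤ T) :
    bitExp (armProb ε j) (fun ω : Fin T × Fin K → Bool =>
      excess L (resampler K T M) T j (ω₁, ω)) =
    ε * (M - bitExp (armProb ε j) (fun ω : Fin T × Fin K → Bool =>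
      pulls j (hist L (resampler K T M) (ω₁, ω) M))) := by
  have hp := sum_armProb ε j
  have hval : ∀ i, armProb ε j i true = 1 / 2 - ε * if i = j then 1 else 0 := by
    intro i
    by_cases h : i = j <;> simp [armProb, h]
  have hcut : ∀ ω : Fin T × Fin K → Bool, excess L (resampler K T M) T j (ω₁, ω) =
      ∑ t ∈ Finset.range M, (lossVec L (resampler K T M) (ω₁, ω) t
        (arm L (resampler K T M) (ω₁, ω) t) - lossVec L (resampler K T M) (ω₁, ω) t j) := by
    intro ω
    rw [excess, ← Finset.sum_sub_distrib]
    refine (Finset.sum_subset (Finset.range_subset_range.2 hM) fun t _ ht => ?_).symm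
    have ht' : M ≤ t := by simpa using ht
    rw [lossVec_resampler_of_le _ _ ht', lossVec_resampler_of_le _ _ ht', sub_zero]
  have hround : ∀ t ∈ Finset.range M, bitExp (armProb ε j) (fun ω : Fin T × Fin K → Bool =>
      lossVec L (resampler K T M) (ω₁, ω) t (arm L (resampler K T M) (ω₁, ω) t) -
        lossVec L (resampler K T M) (ω₁, ω) t j) =
      ε - ε * bitExp (armProb ε j) (fun ω : Fin T × Fin K → Bool =>
        if arm L (resampler K T M) (ω₁, ω) t = j then 1 else 0) := by
    intro t ht
    have ht' := Finset.mem_range.1 ht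
    have h1 := bitExp_lossVec hp L ω₁ ht' hM (fun h => L.act t ω₁ h)
    have h2 := bitExp_lossVec hp L ω₁ ht' hM (fun _ => j)
    simp_rw [arm_eq_act_hist L _ _ t]
    rw [bitExp_sub]
    refine (congrArg₂ (· - ·) h1 h2).trans ?_
    simp_rw [hval, bitExp_sub, bitExp_const_mul, bitExp_const hp]
    simp
  have hpulls : ∀ ω : Fin T × Fin K → Bool, pulls j (hist L (resampler K T M) (ω₁, ω) M) =
      ∑ t ∈ Finset.range M, if arm L (resampler K T M) (ω₁, ω) t = j then 1 else 0 := by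
    intro ω
    rw [Finset.sum_range]; rfl
  simp_rw [hcut, hpulls, bitExp_sum]
  rw [Finset.sum_congr rfl hround, Finset.sum_sub_distrib, ← Finset.mul_sum]
  simp
  ring

/-- On average over the position of the best arm, every learner has large expected excess loss. -/
theorem le_sum_bitExp_excess {ε : ℝ} (hK : 2 ≤ K) (h0 : 0 ≤ ε) (h1 : ε ≤ 1 / 4)
    (h2 : 1024 * ε ^ 2 * M ≤ K) (L : Learner K Ω₁) (ω₁ : Ω₁) (hM : M ≤ T) :
    K * (3 / 8 * (ε * M)) ≤ ∑ j, bitExp (armProb ε j) (fun ω : Fin T × Fin K → Bool =>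
      excess L (resampler K T M) T j (ω₁, ω)) := by
  simp_rw [bitExp_excess ε _ L ω₁ hM]
  rw [← Finset.mul_sum, Finset.sum_sub_distrib]
  have h3 := Finset.sum_le_sum fun j (_ : j ∈ Finset.univ) => bitExp_pulls_le h0 h1 j L ω₁ hM
  rw [Finset.sum_add_distrib, ← Finset.mul_sum, ← bitExp_sum] at h3
  simp_rw [sum_pulls] at h3
  rw [bitExp_const sum_fairProb] at h3
  simp only [Finset.sum_const, Finset.card_univ, Fintype.card_fin, nsmul_eq_mul] at h3 ⊢
  have hK' : (2 : ℝ) ≤ K := by exact_mod_cast hK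
  have hM' : (0 : ℝ) ≤ M := Nat.cast_nonneg M
  -- Here 1 ≤ K/2 and 64ε²M ≤ K/16, and 1/2 + 1/16 + 1/16 = 5/8.
  have h4 : (1 + 64 * ε ^ 2 * M) * M + K * (M / 16) ≤ K * (5 / 8 * M) := by
    have h5 := mul_le_mul_of_nonneg_right h2 hM'
    have h6 := mul_le_mul_of_nonneg_right hK' hM'
    linarith
  have h7 := mul_le_mul_of_nonneg_left (h3.trans h4) h0
  linarith

end ChangeOfMeasure

/-! ### Realizing the weights as a product measure -/

section BitMeasure

/-- The law of a bit with weights `p`. -/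
noncomputable def bitLaw (p : Bool → ℝ) : Measure Bool :=
  ∑ b, ENNReal.ofReal (p b) • Measure.dirac b

theorem isProbabilityMeasure_bitLaw {p : Bool → ℝ} (h0 : ∀ b, 0 ≤ p b) (h1 : ∑ b, p b = 1) :
    IsProbabilityMeasure (bitLaw p) := by
  constructor
  rw [Fintype.sum_bool] at h1
  simp [bitLaw]
  rw [← ENNReal.ofReal_add (h0 _) (h0 _), h1, ENNReal.ofReal_one]

theorem bitLaw_real_singleton {p : Bool → ℝ} (h0 : ∀ b, 0 ≤ p b) (b : Bool) :
    (bitLaw p).real {b} = p b := by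
  cases b <;> simp [bitLaw, Measure.real, h0]

/-- The law of independent bits, those of arm `i` having weights `p i`. -/
noncomputable def bitsLaw {K : ℕ} (T : ℕ) (p : Fin K → Bool → ℝ) :
    Measure (Fin T × Fin K → Bool) :=
  Measure.pi fun c => bitLaw (p c.2)

variable {K T M : ℕ} {p : Fin K → Bool → ℝ}

theorem isProbabilityMeasure_bitsLaw (h0 : ∀ i b, 0 ≤ p i b) (h1 : ∀ i, ∑ b, p i b = 1) :
    IsProbabilityMeasure (bitsLaw T p) := by
  have := fun i => isProbabilityMeasure_bitLaw (h0 i) (h1 i)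
  unfold bitsLaw
  infer_instance

theorem integral_bitsLaw (h0 : ∀ i b, 0 ≤ p i b) (h1 : ∀ i, ∑ b, p i b = 1)
    (F : (Fin T × Fin K → Bool) → ℝ) : ∫ ω, F ω ∂(bitsLaw T p) = bitExp p F := by
  have := fun i => isProbabilityMeasure_bitLaw (h0 i) (h1 i)
  have := isProbabilityMeasure_bitsLaw (T := T) h0 h1
  rw [integral_fintype Integrable.of_finite, bitExp]
  refine Finset.sum_congr rfl fun ω _ => ?_
  rw [smul_eq_mul]
  congr 1
  rw [Measure.real, bitsLaw, Measure.pi_singleton, ENNReal.toReal_prod]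
  exact Finset.prod_congr rfl fun c _ => bitLaw_real_singleton (h0 c.2) (ω c)

theorem resamplesLastArm_resampler (h0 : ∀ i b, 0 ≤ p i b) (h1 : ∀ i, ∑ b, p i b = 1) {τ : ℝ}
    (hτ : 0 ≤ τ) : ResamplesLastArm (resampler K T ⌊τ⌋₊) (bitsLaw T p) T τ := by
  have := fun i => isProbabilityMeasure_bitLaw (h0 i) (h1 i)
  -- Translates between rounds counted from 0 and the real cutoff `τ`.
  have hlt : ∀ t : ℕ, t < ⌊τ⌋₊ ↔ (t : ℝ) + 1 ≤ τ := by
    intro t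
    rw [← Nat.succ_le_iff, Nat.le_floor_iff hτ]
    push_cast; rfl
  refine ⟨fun t i ω => bitVal (ω (t, i)), fun t i => measurable_of_finite _, ?_, ?_, ?_, ?_, ?_⟩
  · exact iIndepFun_pi (μ := fun c : Fin T × Fin K => bitLaw (p c.2)) (X := fun _ => bitVal)
      fun _ => (measurable_of_finite _).aemeasurable
  · intro s t i
    have hmap : ∀ r : Fin T, (bitsLaw T p).map (fun ω => ω (r, i)) = bitLaw (p i) := fun r =>
      (measurePreserving_eval (fun c : Fin T × Fin K => bitLaw (p c.2)) (r, i)).map_eq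
    have : IdentDistrib (fun ω : Fin T × Fin K → Bool => ω (s, i)) (fun ω => ω (t, i))
        (bitsLaw T p) (bitsLaw T p) :=
      ⟨(measurable_pi_apply _).aemeasurable, (measurable_pi_apply _).aemeasurable,
        by rw [hmap, hmap]⟩
    exact this.comp (measurable_of_finite bitVal)
  · intro hT h1 ω h i
    have : (0 : ℕ) < ⌊τ⌋₊ := (hlt 0).2 (by simpa using h1)
    simp [resampler, this, src, bit, hT]
  · intro s hs hsτ ω h i
    have h2 : s + 1 < ⌊τ⌋₊ := (hlt _).2 (by push_cast; linarith)
    have h3 : s < ⌊τ⌋₊ := by omega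
    simp only [resampler, h2, h3, if_true, src]
    split_ifs with h4
    · simp [bit, hs]
    · rfl
  · intro t _ ht ω h i
    have : ¬ t < ⌊τ⌋₊ := fun h => absurd ((hlt t).1 h) (not_le.2 ht)
    simp [resampler, this]

end BitMeasure

/-! ### Path length of the resampling adversary -/

section PathLength

variable {K T M : ℕ} {Ω₁ : Type*} [MeasurableSpace Ω₁]

theorem sum_abs_le (x y : Fin K → ℝ) (hx : ∀ i, x i ∈ Set.Icc (0 : ℝ) 1)
    (hy : ∀ i, y i ∈ Set.Icc (0 : ℝ) 1) : ∑ i, |x i - y i| ≤ K := by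
  refine (Finset.sum_le_card_nsmul _ _ 1 fun i _ => ?_).trans (by simp)
  rw [abs_le]
  exact ⟨by linarith [(hx i).1, (hy i).2], by linarith [(hx i).2, (hy i).1]⟩

/-- The three terms are the initial jump from zero, the final drop to zero, and the single resampled
coordinate. -/
theorem sum_abs_step_le (L : Learner K Ω₁) (ω : Ω₁ × (Fin T × Fin K → Bool)) (t : ℕ) :
    ∑ i, |lossVec L (resampler K T M) ω t i - prevLossVec L (resampler K T M) ω t i| ≤
      (if t = 0 then (K : ℝ) else 0) + (if t = M then (K : ℝ) else 0) +
        (if t < M then 1 else 0) := by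
  have hK : (0 : ℝ) ≤ K := Nat.cast_nonneg K
  rcases t with _ | t
  · have h := sum_abs_le (lossVec L (resampler K T M) ω 0) 0 (lossVec_mem L _ ω 0) (by simp)
    simp only [prevLossVec, if_true]
    refine h.trans ?_
    split_ifs <;> linarith
  · simp only [prevLossVec, Nat.succ_ne_zero, if_false, zero_add]
    rcases lt_trichotomy (t + 1) M with h | h | h
    · simp only [h, h.ne, if_true, if_false, zero_add]
      have h1 : ∀ i, |lossVec L (resampler K T M) ω (t + 1) i - lossVec L (resampler K T M) ω t i| ≤
          if i = arm L (resampler K T M) ω t then 1 else 0 := by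
        intro i
        have h2 := lossVec_mem L (resampler K T M) ω (t + 1) i
        have h3 := lossVec_mem L (resampler K T M) ω t i
        split_ifs with hi
        · rw [abs_le]
          exact ⟨by linarith [h2.1, h3.2], by linarith [h2.2, h3.1]⟩
        · rw [lossVec_resampler L ω h, lossVec_resampler L ω (by omega : t < M), src,
            if_neg (by exact hi)]
          simp
      exact (Finset.sum_le_sum fun i _ => h1 i).trans (by simp)
    · simp only [h, if_true, lt_irrefl, if_false, add_zero]
      rw [← h]
      exact sum_abs_le _ _ (lossVec_mem L _ ω _) (lossVec_mem L _ ω _)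
    · simp only [h.ne', h.not_gt, if_false, add_zero]
      rw [Finset.sum_eq_zero]
      intro i _
      rw [lossVec_resampler_of_le L ω h.le, lossVec_resampler_of_le L ω (by omega : M ≤ t)]
      simp

theorem pathLength_resampler_le (L : Learner K Ω₁) (P : Measure Ω₁) [IsProbabilityMeasure P]
    (Q : Measure (Fin T × Fin K → Bool)) [IsProbabilityMeasure Q] (hM : M ≤ T) :
    pathLength L (resampler K T M) P Q T ≤ 2 * K + M := by
  have hpt : ∀ ω, ∑ t ∈ Finset.range T, ∑ i,
      |lossVec L (resampler K T M) ω t i - prevLossVec L (resampler K T M) ω t i| ≤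
        2 * K + M := by
    intro ω
    refine (Finset.sum_le_sum fun t _ => sum_abs_step_le L ω t).trans ?_
    rw [Finset.sum_add_distrib, Finset.sum_add_distrib]
    have hK : (0 : ℝ) ≤ K := Nat.cast_nonneg K
    have h1 : ∀ a, ∑ t ∈ Finset.range T, (if t = a then (K : ℝ) else 0) ≤ K := by
      intro a
      rw [Finset.sum_ite_eq']
      split_ifs
      · exact le_rfl
      · exact hK
    have h2 : ∑ t ∈ Finset.range T, (if t < M then (1 : ℝ) else 0) = M := by
      rw [Finset.sum_boole]
      congr 1
      rw [show (Finset.range T).filter (· < M) = Finset.range M by ext; simp; omega]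
      simp
    linarith [h1 0, h1 M]
  refine (integral_mono_of_nonneg (ae_of_all _ fun ω => ?_) (integrable_const (2 * (K : ℝ) + M))
    (ae_of_all _ hpt)).trans (by simp)
  exact Finset.sum_nonneg fun _ _ => Finset.sum_nonneg fun _ _ => abs_nonneg _

end PathLength

/-! ### From fixed learner seeds to the regret -/

section Regret

variable {K T M : ℕ} {Ω₁ : Type*} [MeasurableSpace Ω₁]

/-- Some position of the best arm forces large regret. -/
theorem exists_le_regret {ε : ℝ} (hK : 2 ≤ K) (h0 : 0 ≤ ε) (h1 : ε ≤ 1 / 4)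
    (h2 : 1024 * ε ^ 2 * M ≤ K) (hM : M ≤ T) (L : Learner K Ω₁) (P : Measure Ω₁)
    [IsProbabilityMeasure P] :
    ∃ j, 3 / 8 * (ε * M) ≤ regret L (resampler K T M) P (bitsLaw T (armProb ε j)) T := by
  have hp0 : ∀ j i b, 0 ≤ armProb (K := K) ε j i b := armProb_nonneg h0 (by linarith)
  have hQ : ∀ j : Fin K, IsProbabilityMeasure (bitsLaw T (armProb ε j)) := fun j =>
    isProbabilityMeasure_bitsLaw (hp0 j) (sum_armProb ε j)
  have hint : ∀ j : Fin K, Integrable (excess L (resampler K T M) T j)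
      (P.prod (bitsLaw T (armProb ε j))) := fun j => integrable_excess L _ T j _ _
  have hfub : ∀ j : Fin K, ∫ ω, excess L (resampler K T M) T j ω
      ∂(P.prod (bitsLaw T (armProb ε j))) = ∫ ω₁, bitExp (armProb ε j)
        (fun ω : Fin T × Fin K → Bool => excess L (resampler K T M) T j (ω₁, ω)) ∂P := by
    intro j
    rw [integral_prod _ (hint j)]
    simp_rw [integral_bitsLaw (hp0 j) (sum_armProb ε j)]
  have hint' : ∀ j : Fin K, Integrable (fun ω₁ => bitExp (armProb ε j)
      (fun ω : Fin T × Fin K → Bool => excess L (resampler K T M) T j (ω₁, ω))) P := by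
    intro j
    have := (hint j).integral_prod_left
    simp_rw [integral_bitsLaw (hp0 j) (sum_armProb ε j)] at this
    exact this
  have hsum : ∑ _j : Fin K, 3 / 8 * (ε * M) ≤ ∑ j : Fin K,
      ∫ ω, excess L (resampler K T M) T j ω ∂(P.prod (bitsLaw T (armProb ε j))) := by
    simp_rw [hfub]
    rw [← integral_finsetSum _ fun j _ => hint' j]
    have h3 := integral_mono (μ := P) (integrable_const (K * (3 / 8 * (ε * M))))
      (integrable_finsetSum _ fun j _ => hint' j)
      (fun ω₁ => le_sum_bitExp_excess hK h0 h1 h2 L ω₁ hM)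
    simpa using h3
  -- The pigeonhole comes after integrating over the learner's seed, so `j` does not depend on that
  -- seed.
  have hne : (Finset.univ : Finset (Fin K)).Nonempty := ⟨⟨0, by omega⟩, Finset.mem_univ _⟩
  obtain ⟨j, -, hj⟩ := Finset.exists_le_of_sum_le hne hsum
  exact ⟨j, hj.trans (le_ciSup (f := fun i => ∫ ω, excess L (resampler K T M) T i ω
    ∂(P.prod (bitsLaw T (armProb ε j)))) (Set.finite_range _).bddAbove j)⟩

end Regret

end Bandit

/-! ### Choice of parameters -/

theorem theorem1 :
    ∃ C c : ℝ, 0 < C ∧ 0 < c ∧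
      ∀ (K T : ℕ), 2 ≤ K → K ≤ T →
      ∀ γ : ℝ, (K : ℝ) / (T : ℝ) ≤ γ → γ ≤ 1 →
      ∀ (Ω₁ : Type*) [MeasurableSpace Ω₁] (P : Measure Ω₁) [IsProbabilityMeasure P]
        (L : Bandit.Learner K Ω₁),
      ∃ (Ω₂ : Type) (_ : MeasurableSpace Ω₂) (Q : Measure Ω₂) (_ : IsProbabilityMeasure Q)
        (A : Bandit.Adversary K Ω₂),
        Bandit.ResamplesLastArm A Q T (T * γ) ∧
        Bandit.pathLength L A P Q T ≤ C * (T * γ) ∧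
        c * Real.sqrt (K * T * γ) ≤ Bandit.regret L A P Q T ∧
        c * Real.sqrt (K * Bandit.pathLength L A P Q T) ≤ Bandit.regret L A P Q T := by
  refine ⟨3, 3 / 512, by norm_num, by norm_num, ?_⟩
  intro K T hK hKT γ hγ hγ1 Ω₁ _ P _ L
  have hK' : (2 : ℝ) ≤ K := by exact_mod_cast hK
  have hT' : (0 : ℝ) < T := by exact_mod_cast (by omega : 0 < T)
  have hKτ : (K : ℝ) ≤ T * γ := by
    rw [div_le_iff₀ hT'] at hγ
    linarith
  have hτT : T * γ ≤ T := by nlinarith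
  have hτ0 : 0 ≤ T * γ := by linarith
  set M := ⌊T * γ⌋₊ with hMdef
  have hKM : (K : ℝ) ≤ M := by exact_mod_cast Nat.le_floor hKτ
  have hMτ : (M : ℝ) ≤ T * γ := Nat.floor_le hτ0
  have hτM : T * γ < M + 1 := Nat.lt_floor_add_one _
  have hMT : M ≤ T := by exact_mod_cast hMτ.trans hτT
  have hM0 : (0 : ℝ) < M := by linarith
  -- The largest gap allowed by 1024ε²M ≤ K.
  set ε : ℝ := Real.sqrt (K / M) / 32 with hε
  have hε0 : 0 ≤ ε := by positivity
  have hsq : Real.sqrt (K / M) ^ 2 = K / M := Real.sq_sqrt (by positivity)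
  have hε1 : ε ≤ 1 / 4 := by
    have : Real.sqrt (K / M) ≤ 1 := by
      rw [Real.sqrt_le_left zero_le_one, one_pow]
      exact (div_le_one hM0).2 hKM
    linarith
  have hε2 : 1024 * ε ^ 2 * M ≤ K := by
    rw [hε, div_pow, hsq]
    field_simp
    norm_num
  have hεM : ε * M = Real.sqrt (K * M) / 32 := by
    have : Real.sqrt (K / M) * M = Real.sqrt (K * M) := by
      rw [eq_comm, Real.sqrt_eq_iff_mul_self_eq (by positivity) (by positivity)]
      have : Real.sqrt (K / M) * M * (Real.sqrt (K / M) * M) = Real.sqrt (K / M) ^ 2 * M ^ 2 := by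
        ring
      rw [this, hsq]
      field_simp
    rw [hε, ← this]; ring
  obtain ⟨j, hj⟩ := Bandit.exists_le_regret hK hε0 hε1 hε2 hMT L P
  have hp0 : ∀ i b, 0 ≤ Bandit.armProb ε j i b := Bandit.armProb_nonneg hε0 (by linarith) j
  have hQ := Bandit.isProbabilityMeasure_bitsLaw (T := T) hp0 (Bandit.sum_armProb ε j)
  have hpath := Bandit.pathLength_resampler_le L P (Bandit.bitsLaw T (Bandit.armProb ε j)) hMT
  -- The regret is at least 3/8 · √(KM)/32 = 3/256 · √(KM); the constant is halved because √x ≤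
  -- 2√(KM). Both final bounds are instances, as `T * γ` and the path length are at most `4 * M`.
  have hbound : ∀ x : ℝ, x ≤ 4 * (K * M) → 3 / 512 * Real.sqrt x ≤
      Bandit.regret L (Bandit.resampler K T M) P (Bandit.bitsLaw T (Bandit.armProb ε j)) T := by
    intro x hx
    have h4 : Real.sqrt (4 * (K * M)) = 2 * Real.sqrt (K * M) := by
      rw [Real.sqrt_mul (by norm_num), show (4 : ℝ) = 2 ^ 2 by norm_num,
        Real.sqrt_sq (by norm_num)]
    have h5 := Real.sqrt_le_sqrt hx
    rw [hεM] at hj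
    linarith
  refine ⟨_, _, _, hQ, Bandit.resampler K T M,
    Bandit.resamplesLastArm_resampler hp0 (Bandit.sum_armProb ε j) hτ0, by linarith,
    hbound _ ?_, hbound _ ?_⟩
  · have h6 : T * γ ≤ 4 * M := by linarith
    have h7 := mul_le_mul_of_nonneg_left h6 (Nat.cast_nonneg (α := ℝ) K)
    linarith
  · have h7 := mul_le_mul_of_nonneg_left (hpath.trans (by linarith : _ ≤ 4 * (M : ℝ)))
      (Nat.cast_nonneg (α := ℝ) K)
    linarith
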